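/- Let $L>0$, $I=[0,L]$, $\rho\in\mathbb{R}$, $Q_0\in H^2(\mathbb{R})$, and let $Q\in C(I,H^2(\mathbb{R}))\cap C^1(I,L^2(\mathbb{R}))$ be an $H^2$-solution on $I$ of the initial value problem $$ iQ_Z+Q_{TT}+\rho|Q|^2Q=0,\qquad Q(0,T)=Q_0(T), $$ i.e. the equation holds in $L^2(\mathbb{R})$ for every $Z\in I$, and $Q(0)=Q_0$. Here $Q=Q(Z,T)$ is complex-valued, with $Z\in I$ and $T\in\mathbb{R}$. Assume that $T^2Q_0\in L^2(\mathbb{R})$ and $|T|\,Q_0'\in L^2(\mathbb{R})$. Then $T^2Q(Z,\cdot)\in L^2(\mathbb{R})$ and $TQ_T(Z,\cdot)\in L^2(\mathbb{R})$ for every $Z\in I$; the functions $Z\mapsto T^2Q(Z,\cdot)$ and $Z\mapsto TQ_T(Z,\cdot)$ belong to $L^\infty(I,L^2(\mathbb{R}))$; $\|T^2Q(Z,\cdot)\|_{L^2}$ is bounded on $I$; and $$ \|T^2Q(Z,\cdot)\|_{L^2}\le\|T^2Q_0\|_{L^2}+4\int_0^Z\|TQ_T(Z',\cdot)\|_{L^2}\,dZ'\qquad\text{for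 every } Z\in I. $$ -/

import Mathlib

open MeasureTheory Set
open scoped ENNReal

noncomputable section

/-- The complex Hilbert space `L²(ℝ)` (Lebesgue measure). -/
abbrev L2R : Type := Lp ℂ 2 (volume : Measure ℝ)

/-- `g ∈ L²(ℝ)` is the weak derivative of `f ∈ L²(ℝ)`: one has `∫ f φ' = - ∫ g φ` for every
continuously differentiable compactly supported test function `φ`. -/
def IsWeakDeriv (f g : L2R) : Prop :=
  ∀ φ : ℝ → ℂ, ContDiff ℝ 1 φ → HasCompactSupport φ →
    ∫ T, f T * deriv φ T = - ∫ T, g T * φ T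

/-- A square integrable function is integrable against a continuous compactly supported one. -/
theorem integrable_L2R_mul (f : L2R) {ψ : ℝ → ℂ} (hψ : Continuous ψ)
    (hc : HasCompactSupport ψ) : Integrable (fun T => f T * ψ T) := by
  have h2 : MemLp ψ 2 (volume : Measure ℝ) := hψ.memLp_of_hasCompactSupport hc
  exact (Lp.memLp f).integrable_mul h2

theorem integrable_L2R_mul_deriv (f : L2R) {φ : ℝ → ℂ} (hφ : ContDiff ℝ 1 φ)
    (hc : HasCompactSupport φ) : Integrable (fun T => f T * deriv φ T) :=
  integrable_L2R_mul f (hφ.continuous_deriv le_rfl) hc.deriv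

theorem isWeakDeriv_zero : IsWeakDeriv 0 0 := by
  intro φ _ _
  have h : ∀ ψ : ℝ → ℂ, ∫ T, (0 : L2R) T * ψ T = 0 := by
    intro ψ
    refine integral_eq_zero_of_ae ?_
    filter_upwards [Lp.coeFn_zero ℂ 2 (volume : Measure ℝ)] with T hT
    rw [hT, Pi.zero_apply, zero_mul]
  rw [h, h, neg_zero]

theorem IsWeakDeriv.add {f₁ g₁ f₂ g₂ : L2R} (h₁ : IsWeakDeriv f₁ g₁) (h₂ : IsWeakDeriv f₂ g₂) :
    IsWeakDeriv (f₁ + f₂) (g₁ + g₂) := by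
  intro φ hφ hc
  have e : ∀ (a b : L2R) (ψ : ℝ → ℂ),
      (fun T => (a + b : L2R) T * ψ T) =ᵐ[volume] fun T => a T * ψ T + b T * ψ T := by
    intro a b ψ
    filter_upwards [Lp.coeFn_add a b] with T hT
    rw [hT, Pi.add_apply, add_mul]
  rw [integral_congr_ae (e f₁ f₂ _), integral_congr_ae (e g₁ g₂ _),
    integral_add (integrable_L2R_mul_deriv f₁ hφ hc) (integrable_L2R_mul_deriv f₂ hφ hc),
    integral_add (integrable_L2R_mul g₁ hφ.continuous hc)
      (integrable_L2R_mul g₂ hφ.continuous hc), h₁ φ hφ hc, h₂ φ hφ hc]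
  ring

theorem IsWeakDeriv.smul (c : ℂ) {f g : L2R} (h : IsWeakDeriv f g) :
    IsWeakDeriv (c • f) (c • g) := by
  intro φ hφ hc
  have e : ∀ (a : L2R) (ψ : ℝ → ℂ),
      (fun T => (c • a : L2R) T * ψ T) =ᵐ[volume] fun T => c * (a T * ψ T) := by
    intro a ψ
    filter_upwards [Lp.coeFn_smul c a] with T hT
    rw [hT, Pi.smul_apply, smul_eq_mul, mul_assoc]
  rw [integral_congr_ae (e f _), integral_congr_ae (e g _), integral_const_mul,
    integral_const_mul, h φ hφ hc]
  ring

/-- The triples `(u, u', u'')` consisting of an `L²` function and its first and second weak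
derivatives, all three in `L²(ℝ)`. -/
def sobolevH2 : Submodule ℂ (PiLp 2 (fun _ : Fin 3 => L2R)) where
  carrier := {u | IsWeakDeriv (u 0) (u 1) ∧ IsWeakDeriv (u 1) (u 2)}
  zero_mem' := ⟨isWeakDeriv_zero, isWeakDeriv_zero⟩
  add_mem' := fun ha hb => ⟨ha.1.add hb.1, ha.2.add hb.2⟩
  smul_mem' := fun c _ hu => ⟨hu.1.smul c, hu.2.smul c⟩

/-- The Sobolev space `H²(ℝ)`. An element is stored as the triple `(u, u', u'')`; weak derivatives
are unique, so the triple is determined by `u`. The norm inherited from the `ℓ²`-product is the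
usual one, `‖u‖² = ‖u‖²_{L²} + ‖u'‖²_{L²} + ‖u''‖²_{L²}`. -/
abbrev H2R : Type := sobolevH2

namespace H2R

/-- The function `u ∈ L²(ℝ)` underlying an element of `H²(ℝ)`. -/
def toL2 (u : H2R) : L2R := u.1 0

/-- The first weak derivative `u'` of `u ∈ H²(ℝ)`. -/
def d1 (u : H2R) : L2R := u.1 1

/-- The second weak derivative `u''` of `u ∈ H²(ℝ)`. -/
def d2 (u : H2R) : L2R := u.1 2

end H2R

/-- `Q` is an `H²`-solution on `I = [0, L]` of the initial value problem
`i Q_Z + Q_TT + ρ |Q|² Q = 0`, `Q(0) = Q₀`: it belongs to `C(I, H²(ℝ)) ∩ C¹(I, L²(ℝ))`, and the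
equation holds in `L²(ℝ)`, i.e. almost everywhere in `T`, at each `Z ∈ I`. Only the values of `Q`
on `I` matter; at the end points of `I` the derivative is one-sided. -/
structure IsH2Solution (ρ L : ℝ) (Q₀ : H2R) (Q : ℝ → H2R) : Prop where
  continuousOn : ContinuousOn Q (Icc 0 L)
  exists_deriv : ∃ QZ : ℝ → L2R, ContinuousOn QZ (Icc 0 L) ∧
    (∀ Z ∈ Icc 0 L, HasDerivWithinAt (fun s => (Q s).toL2) (QZ Z) (Icc 0 L) Z) ∧
    (∀ Z ∈ Icc 0 L, ∀ᵐ T : ℝ, Complex.I * QZ Z T + (Q Z).d2 T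
      + (ρ : ℂ) * (‖(Q Z).toL2 T‖ : ℂ) ^ 2 * (Q Z).toL2 T = 0)
  initial : Q 0 = Q₀

end

/-!
# Propagation of the weighted norms `‖T² Q‖` and `‖T Q_T‖`

Formally, `d/dZ ‖T² Q‖² = 2 Re ⟪T⁴ Q, Q_Z⟫`. The cubic term of the equation acts by a real potential
and drops out, and one integration by parts leaves `8 Im ∫ T³ conj Q Q_T ≤ 8 ‖T² Q‖ ‖T Q_T‖`, which
is the asserted inequality. No equation for `Q_T` is needed to control `‖T Q_T‖`: a second
integration by parts gives `‖T Q_T‖² ≤ ‖T² Q‖ ‖Q_TT‖ + 2 ‖T Q_T‖ ‖Q‖`, so `‖T Q_T‖` is at most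
`‖T² Q‖ + 3 M`, where `M` bounds the `H²` norm on `I`. Grönwall's inequality then bounds `‖T² Q‖`.

To make this rigorous, `T²` and `T` are replaced by the bounded weights `a = k T² / (k + T²)` and
`b = k T / (k + T²)` with `k = n + 1`. They satisfy `|a'| ≤ 2 |b|`, `b² ≤ a` and `|b'| ≤ 1`, so both
estimates survive with constants independent of `n` (`inner_quadWeight_le` and
`norm_linWeight_d1_le`). The limit `n → ∞` is taken by Fatou's lemma
(`memLp_of_norm_weightMul_le`) and dominated convergence (`tendsto_weightMul`), the latter also
giving measurability in `Z`.

Integration by parts on `ℝ` for weak derivatives (`IsWeakDeriv.inner_eq_neg`) comes from the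
correlation function of the two factors, without mollification or cut-off.
-/

open Filter Topology
open scoped ComplexConjugate BoundedContinuousFunction ContDiff

noncomputable section

/-! ### Integration by parts for weak derivatives -/

/-- The translate `T ↦ f (y + T)` of a square integrable function `f`. -/
def L2R.translate (y : ℝ) (f : L2R) : L2R :=
  Lp.compMeasurePreserving (fun T => y + T) (measurePreserving_add_left volume y) f

theorem L2R.coeFn_translate (y : ℝ) (f : L2R) :
    L2R.translate y f =ᵐ[volume] fun T => f (y + T) :=
  Lp.coeFn_compMeasurePreserving f (measurePreserving_add_left volume y)

theorem L2R.translate_zero (f : L2R) : L2R.translate 0 f = f := by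
  refine Lp.ext ?_
  filter_upwards [L2R.coeFn_translate 0 f] with T hT
  rw [hT, zero_add]

theorem L2R.continuous_translate (f : L2R) : Continuous fun y => L2R.translate y f := by
  refine Continuous.compMeasurePreservingLp (f := fun _ : ℝ => f)
    (g := fun y : ℝ => (⟨fun T => y + T, by fun_prop⟩ : C(ℝ, ℝ))) continuous_const ?_
    (fun y => measurePreserving_add_left volume y) (by simp)
  exact (ContinuousMap.curry ⟨fun p : ℝ × ℝ => p.1 + p.2, by fun_prop⟩).continuous

theorem L2R.inner_translate (f h : L2R) (y : ℝ) :
    inner ℂ f (L2R.translate y h) = ∫ T, conj (f T) * h (y + T) := by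
  rw [L2.inner_def]
  refine integral_congr_ae ?_
  filter_upwards [L2R.coeFn_translate y h] with T hT
  rw [hT, RCLike.inner_apply, mul_comm]

/-- Moving the translation to the other factor, by invariance of the Lebesgue measure. -/
theorem L2R.inner_translate_neg (f h : L2R) (y : ℝ) :
    inner ℂ f (L2R.translate (-y) h) = conj (inner ℂ h (L2R.translate y f)) := by
  rw [L2R.inner_translate, L2R.inner_translate, ← integral_conj,
    ← integral_add_left_eq_self (fun T => conj (f T) * h (-y + T)) y]
  refine integral_congr_ae (ae_of_all _ fun T => ?_)
  simp [mul_comm]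

theorem L2R.integrable_mul_inner_translate (f h : L2R) {φ : ℝ → ℝ} (hφ : Continuous φ)
    (hc : HasCompactSupport φ) :
    Integrable (fun p : ℝ × ℝ => (φ p.1 : ℂ) * (conj (f p.2) * h (p.1 + p.2)))
      (volume.prod volume) := by
  have hmp := measurePreserving_prod_add (volume : Measure ℝ) (volume : Measure ℝ)
  have hφi : Integrable φ := hφ.integrable_of_hasCompactSupport hc
  have hsq : ∀ u : L2R, Integrable fun T => ‖u T‖ ^ 2 := fun u =>
    (memLp_two_iff_integrable_sq_norm (Lp.aestronglyMeasurable u)).1 (Lp.memLp u)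
  have i1 : Integrable (fun p : ℝ × ℝ => |φ p.1| * ‖f p.2‖ ^ 2) (volume.prod volume) :=
    hφi.abs.mul_prod (hsq f)
  have i2 : Integrable (fun p : ℝ × ℝ => |φ p.1| * ‖h (p.1 + p.2)‖ ^ 2) (volume.prod volume) :=
    hmp.integrable_comp_of_integrable (hφi.abs.mul_prod (hsq h))
  refine (i1.add i2).mono' ?_ (ae_of_all _ fun p => ?_)
  · have mh : AEStronglyMeasurable (fun p : ℝ × ℝ => h (p.1 + p.2)) (volume.prod volume) :=
      (Lp.aestronglyMeasurable h).comp_snd.comp_measurePreserving hmp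
    have mf : AEStronglyMeasurable (fun p : ℝ × ℝ => conj (f p.2)) (volume.prod volume) :=
      Complex.continuous_conj.comp_aestronglyMeasurable (Lp.aestronglyMeasurable f).comp_snd
    have mφ : AEStronglyMeasurable (fun p : ℝ × ℝ => (φ p.1 : ℂ)) (volume.prod volume) :=
      (by fun_prop : Continuous fun p : ℝ × ℝ => (φ p.1 : ℂ)).aestronglyMeasurable
    exact mφ.mul (mf.mul mh)
  · simp only [norm_mul, RCLike.norm_conj, Complex.norm_real, Real.norm_eq_abs, Pi.add_apply]
    rw [← mul_add]
    gcongr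
    nlinarith [sq_nonneg (‖f p.2‖ - ‖h (p.1 + p.2)‖), sq_nonneg (‖f p.2‖),
      sq_nonneg (‖h (p.1 + p.2)‖)]

/-- Fubini's theorem for the correlation of `f` and `h` tested against `φ`. -/
theorem L2R.integral_mul_inner_translate (f h : L2R) {φ : ℝ → ℝ} (hφ : Continuous φ)
    (hc : HasCompactSupport φ) :
    ∫ y, (φ y : ℂ) * inner ℂ f (L2R.translate y h) =
      ∫ x, conj (f x) * ∫ z, h z * (φ (z - x) : ℂ) := by
  simp_rw [L2R.inner_translate, ← integral_const_mul]
  rw [integral_integral_swap (L2R.integrable_mul_inner_translate f h hφ hc)]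
  refine integral_congr_ae (ae_of_all _ fun x => ?_)
  simp only
  rw [← integral_add_right_eq_self (fun z => conj (f x) * (h z * (φ (z - x) : ℂ))) x]
  refine integral_congr_ae (ae_of_all _ fun y => ?_)
  simp only [add_sub_cancel_right]
  ring

theorem IsWeakDeriv.integral_mul_inner_translate_right (f : L2R) {g g' : L2R}
    (hg : IsWeakDeriv g g') {φ : ℝ → ℝ} (hφ : ContDiff ℝ 1 φ) (hc : HasCompactSupport φ) :
    ∫ y, (φ y : ℂ) * inner ℂ f (L2R.translate y g') =
      - ∫ y, ((deriv φ y : ℝ) : ℂ) * inner ℂ f (L2R.translate y g) := by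
  rw [L2R.integral_mul_inner_translate f g' hφ.continuous hc,
    L2R.integral_mul_inner_translate f g (hφ.continuous_deriv le_rfl) hc.deriv, ← integral_neg]
  refine integral_congr_ae (ae_of_all _ fun x => ?_)
  have hd : ∀ z, deriv (fun z : ℝ => ((φ (z - x) : ℝ) : ℂ)) z = ((deriv φ (z - x) : ℝ) : ℂ) := by
    intro z
    have := (hφ.differentiable one_ne_zero (z - x)).hasDerivAt.comp_sub_const z x
    exact this.ofReal_comp.deriv
  have ht := hg (fun z : ℝ => ((φ (z - x) : ℝ) : ℂ))
    (Complex.ofRealCLM.contDiff.comp (hφ.comp (by fun_prop)))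
    ((hc.comp_homeomorph (Homeomorph.subRight x)).comp_left Complex.ofReal_zero)
  simp only [hd] at ht
  simp only [ht]
  ring

theorem IsWeakDeriv.integral_mul_inner_translate_left {f f' : L2R} (hf : IsWeakDeriv f f')
    (g : L2R) {φ : ℝ → ℝ} (hφ : ContDiff ℝ 1 φ) (hc : HasCompactSupport φ) :
    ∫ y, (φ y : ℂ) * inner ℂ f' (L2R.translate y g) =
      ∫ y, ((deriv φ y : ℝ) : ℂ) * inner ℂ f (L2R.translate y g) := by
  -- Reflect `y` and exchange the two factors, which reduces to a derivative on the right.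
  have key : ∀ (u v : L2R) (ψ : ℝ → ℝ), ∫ y, (ψ y : ℂ) * inner ℂ u (L2R.translate y v) =
      conj (∫ y, (ψ (-y) : ℂ) * inner ℂ v (L2R.translate y u)) := by
    intro u v ψ
    rw [← integral_conj,
      ← integral_neg_eq_self (fun y => (ψ y : ℂ) * inner ℂ u (L2R.translate y v))]
    refine integral_congr_ae (ae_of_all _ fun y => ?_)
    simp only [L2R.inner_translate_neg, map_mul, Complex.conj_ofReal]
  have hd : ∀ y, deriv (fun y => φ (-y)) y = -deriv φ (-y) := fun y => deriv_comp_neg φ y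
  rw [key f' g φ, key f g (deriv φ), IsWeakDeriv.integral_mul_inner_translate_right g hf (φ := fun y => φ (-y))
    (hφ.comp contDiff_neg) (hc.comp_homeomorph (Homeomorph.neg ℝ)), ← integral_neg]
  simp [hd]

/-- Integration by parts on `ℝ`. The correlation function
`y ↦ ⟪f, g'(y + ·)⟫ + ⟪f', g(y + ·)⟫` is continuous and vanishes against every test function, so it
vanishes at `y = 0`. -/
theorem IsWeakDeriv.inner_eq_neg {f f' g g' : L2R} (hf : IsWeakDeriv f f')
    (hg : IsWeakDeriv g g') : inner ℂ f g' = - inner ℂ f' g := by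
  set c : ℝ → ℂ := fun y => inner ℂ f (L2R.translate y g') + inner ℂ f' (L2R.translate y g)
  have ct : ∀ u v : L2R, Continuous fun y => (inner ℂ u (L2R.translate y v) : ℂ) := fun u v =>
    continuous_const.inner (L2R.continuous_translate v)
  have hc : Continuous c := (ct _ _).add (ct _ _)
  have h0 : c =ᵐ[volume] fun _ => 0 := by
    refine ae_eq_zero_of_integral_contDiff_smul_eq_zero hc.locallyIntegrable fun φ hφ hφc => ?_
    have hφ1 : ContDiff ℝ 1 φ := hφ.of_le (by exact_mod_cast le_top)
    have hi : ∀ u v : L2R, Integrable fun y => (φ y : ℂ) * inner ℂ u (L2R.translate y v) :=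
      fun u v => ((Complex.continuous_ofReal.comp hφ.continuous).mul
        (ct u v)).integrable_of_hasCompactSupport
          ((hφc.comp_left Complex.ofReal_zero).mul_right)
    simp only [c, Complex.real_smul, mul_add]
    rw [integral_add (hi _ _) (hi _ _), hg.integral_mul_inner_translate_right f hφ1 hφc,
      hf.integral_mul_inner_translate_left g hφ1 hφc, neg_add_cancel]
  have h1 := congrFun ((hc.ae_eq_iff_eq volume continuous_const).1 h0) 0
  simp only [c, L2R.translate_zero] at h1
  exact eq_neg_of_add_eq_zero_left h1

/-! ### Multiplication by bounded weights -/

theorem memLp_weight_mul (m : ℝ →ᵇ ℝ) (f : L2R) :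
    MemLp (fun T => (m T : ℂ) * f T) 2 (volume : Measure ℝ) := by
  refine (Lp.memLp f).of_le_mul (c := ‖m‖)
    ((by fun_prop : Continuous fun T => (m T : ℂ)).aestronglyMeasurable.mul
      (Lp.aestronglyMeasurable f)) (ae_of_all _ fun T => ?_)
  rw [norm_mul, Complex.norm_real]
  gcongr
  exact m.norm_coe_le_norm T

/-- The bounded operator `f ↦ m f` on `L²(ℝ)`, for a bounded continuous real weight `m`. -/
def weightMul (m : ℝ →ᵇ ℝ) : L2R →L[ℂ] L2R :=
  LinearMap.mkContinuous
    { toFun := fun f => (memLp_weight_mul m f).toLp _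
      map_add' := fun f g => by
        refine Lp.ext ?_
        filter_upwards [(memLp_weight_mul m (f + g)).coeFn_toLp, (memLp_weight_mul m f).coeFn_toLp,
          (memLp_weight_mul m g).coeFn_toLp, Lp.coeFn_add f g,
          Lp.coeFn_add ((memLp_weight_mul m f).toLp _) ((memLp_weight_mul m g).toLp _)]
          with T h1 h2 h3 h4 h5
        rw [h1, h5, Pi.add_apply, h2, h3, h4, Pi.add_apply, mul_add]
      map_smul' := fun c f => by
        refine Lp.ext ?_
        filter_upwards [(memLp_weight_mul m (c • f)).coeFn_toLp, (memLp_weight_mul m f).coeFn_toLp,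
          Lp.coeFn_smul c f, Lp.coeFn_smul c ((memLp_weight_mul m f).toLp _)]
          with T h1 h2 h3 h4
        rw [h1, RingHom.id_apply, h4, Pi.smul_apply, h2, h3, Pi.smul_apply, smul_eq_mul,
          smul_eq_mul, mul_left_comm] }
    ‖m‖ fun f => by
      refine Lp.norm_le_mul_norm_of_ae_le_mul ?_
      filter_upwards [(memLp_weight_mul m f).coeFn_toLp] with T hT
      simp only [LinearMap.coe_mk, AddHom.coe_mk]
      rw [hT, norm_mul, Complex.norm_real]
      gcongr
      exact m.norm_coe_le_norm T

theorem coeFn_weightMul (m : ℝ →ᵇ ℝ) (f : L2R) :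
    weightMul m f =ᵐ[volume] fun T => (m T : ℂ) * f T :=
  (memLp_weight_mul m f).coeFn_toLp

theorem weightMul_mul (m n : ℝ →ᵇ ℝ) (f : L2R) :
    weightMul (m * n) f = weightMul m (weightMul n f) := by
  refine Lp.ext ?_
  filter_upwards [coeFn_weightMul (m * n) f, coeFn_weightMul m (weightMul n f),
    coeFn_weightMul n f] with T h1 h2 h3
  rw [h1, h2, h3, BoundedContinuousFunction.mul_apply, Complex.ofReal_mul, mul_assoc]

theorem inner_weightMul_left (m : ℝ →ᵇ ℝ) (f g : L2R) :
    inner ℂ (weightMul m f) g = inner ℂ f (weightMul m g) := by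
  rw [L2.inner_def, L2.inner_def]
  refine integral_congr_ae ?_
  filter_upwards [coeFn_weightMul m f, coeFn_weightMul m g] with T h1 h2
  rw [h1, h2]
  simp only [RCLike.inner_apply, map_mul, Complex.conj_ofReal]
  ring

theorem weightMul_comm (m n : ℝ →ᵇ ℝ) (f : L2R) :
    weightMul m (weightMul n f) = weightMul n (weightMul m f) := by
  rw [← weightMul_mul, mul_comm, weightMul_mul]

theorem norm_weightMul_le {m n : ℝ →ᵇ ℝ} {c : ℝ} (h : ∀ T, |m T| ≤ c * |n T|) (f : L2R) :
    ‖weightMul m f‖ ≤ c * ‖weightMul n f‖ := by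
  refine Lp.norm_le_mul_norm_of_ae_le_mul ?_
  filter_upwards [coeFn_weightMul m f, coeFn_weightMul n f] with T h1 h2
  rw [h1, h2, norm_mul, norm_mul, Complex.norm_real, Complex.norm_real, ← mul_assoc]
  exact mul_le_mul_of_nonneg_right (h T) (norm_nonneg _)

theorem norm_weightMul_le_self {m : ℝ →ᵇ ℝ} (h : ∀ T, |m T| ≤ 1) (f : L2R) :
    ‖weightMul m f‖ ≤ ‖f‖ := by
  refine Lp.norm_le_norm_of_ae_le ?_
  filter_upwards [coeFn_weightMul m f] with T h1
  rw [h1, norm_mul, Complex.norm_real]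
  exact mul_le_of_le_one_left (norm_nonneg _) (h T)

/-- The product rule `(m f)' = m' f + m f'` for a weak derivative. -/
theorem IsWeakDeriv.weightMul {m m' : ℝ →ᵇ ℝ} (hm : ∀ T, HasDerivAt m (m' T) T) {f f' : L2R}
    (hf : IsWeakDeriv f f') :
    IsWeakDeriv (weightMul m f) (weightMul m' f + weightMul m f') := by
  intro φ hφ hc
  have hmd : deriv m = m' := funext fun T => (hm T).deriv
  have hm1 : ContDiff ℝ 1 m := by
    rw [contDiff_one_iff_deriv, hmd]
    exact ⟨fun T => (hm T).differentiableAt, m'.continuous⟩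
  have hmφ : ContDiff ℝ 1 fun T => (m T : ℂ) * φ T :=
    (Complex.ofRealCLM.contDiff.comp hm1).mul hφ
  have hmφc : HasCompactSupport fun T => (m T : ℂ) * φ T := hc.mul_left
  have hd : ∀ T, deriv (fun T => (m T : ℂ) * φ T) T = m' T * φ T + m T * deriv φ T := fun T =>
    ((hm T).ofReal_comp.mul (hφ.differentiable one_ne_zero T).hasDerivAt).deriv
  have key := hf _ hmφ hmφc
  simp only [hd] at key
  have i1 : Integrable fun T => f T * ((m' T : ℂ) * φ T) :=
    integrable_L2R_mul f (by fun_prop) hc.mul_left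
  have i2 : Integrable fun T => f T * ((m T : ℂ) * deriv φ T) :=
    integrable_L2R_mul f (by have := hφ.continuous_deriv le_rfl; fun_prop) hc.deriv.mul_left
  have i3 : Integrable fun T => f' T * ((m T : ℂ) * φ T) :=
    integrable_L2R_mul f' (by fun_prop) hc.mul_left
  have e1 : ∫ T, _root_.weightMul m f T * deriv φ T = ∫ T, f T * ((m T : ℂ) * deriv φ T) := by
    refine integral_congr_ae ?_
    filter_upwards [coeFn_weightMul m f] with T h
    rw [h]
    ring
  have e2 : ∫ T, (_root_.weightMul m' f + _root_.weightMul m f' : L2R) T * φ T =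
      (∫ T, f T * ((m' T : ℂ) * φ T)) + ∫ T, f' T * ((m T : ℂ) * φ T) := by
    rw [← integral_add i1 i3]
    refine integral_congr_ae ?_
    filter_upwards [coeFn_weightMul m' f, coeFn_weightMul m f',
      Lp.coeFn_add (_root_.weightMul m' f) (_root_.weightMul m f')] with T h1 h2 h3
    rw [h3, Pi.add_apply, h1, h2]
    ring
  simp only [mul_add] at key
  rw [integral_add i1 i2] at key
  rw [e1, e2]
  linear_combination key

/-! ### Truncated weights -/

/-- The truncation `k T² / (k + T²)` of the weight `T²`, where `k = n + 1`. -/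
def quadWeight (n : ℕ) : ℝ →ᵇ ℝ :=
  BoundedContinuousFunction.ofNormedAddCommGroup
    (fun T => (n + 1) * T ^ 2 / (n + 1 + T ^ 2))
    (by fun_prop (disch := intro T; positivity)) (n + 1) fun T => by
      rw [Real.norm_eq_abs, abs_of_nonneg (by positivity), div_le_iff₀ (by positivity)]
      have hn : (0 : ℝ) ≤ n := n.cast_nonneg
      nlinarith [sq_nonneg T]

/-- The truncation `k T / (k + T²)` of the weight `T`, where `k = n + 1`. -/
def linWeight (n : ℕ) : ℝ →ᵇ ℝ :=
  BoundedContinuousFunction.ofNormedAddCommGroup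
    (fun T => (n + 1) * T / (n + 1 + T ^ 2))
    (by fun_prop (disch := intro T; positivity)) (n + 1) fun T => by
      have hn : (0 : ℝ) ≤ n := n.cast_nonneg
      rw [Real.norm_eq_abs, abs_div, abs_mul, abs_of_nonneg (by positivity : (0 : ℝ) ≤ n + 1),
        abs_of_nonneg (by positivity : (0 : ℝ) ≤ n + 1 + T ^ 2), div_le_iff₀ (by positivity)]
      gcongr
      nlinarith [sq_nonneg (|T| - 1), sq_abs T]

/-- The derivative of `quadWeight n`. -/
def quadWeightDeriv (n : ℕ) : ℝ →ᵇ ℝ :=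
  BoundedContinuousFunction.ofNormedAddCommGroup
    (fun T => 2 * (linWeight n T * ((n + 1) / (n + 1 + T ^ 2))))
    (by fun_prop (disch := intro T; positivity)) (2 * ‖linWeight n‖) fun T => by
      rw [norm_mul, norm_mul, Real.norm_ofNat]
      gcongr
      refine (mul_le_of_le_one_right (norm_nonneg _) ?_).trans
        ((linWeight n).norm_coe_le_norm T)
      rw [Real.norm_eq_abs, abs_of_nonneg (by positivity), div_le_one (by positivity)]
      nlinarith [sq_nonneg T]

/-- The derivative of `linWeight n`. -/
def linWeightDeriv (n : ℕ) : ℝ →ᵇ ℝ :=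
  BoundedContinuousFunction.ofNormedAddCommGroup
    (fun T => (n + 1) * (n + 1 - T ^ 2) / (n + 1 + T ^ 2) ^ 2)
    (by fun_prop (disch := intro T; positivity)) 1 fun T => by
      have hn : (0 : ℝ) ≤ n := n.cast_nonneg
      rw [Real.norm_eq_abs, abs_div, abs_of_nonneg (by positivity : (0 : ℝ) ≤ (n + 1 + T ^ 2) ^ 2),
        div_le_one (by positivity), abs_le]
      constructor <;> nlinarith [sq_nonneg T, mul_nonneg hn (sq_nonneg T), sq_nonneg (T ^ 2)]

theorem quadWeight_apply (n : ℕ) (T : ℝ) :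
    quadWeight n T = (n + 1) * T ^ 2 / (n + 1 + T ^ 2) := rfl

theorem linWeight_apply (n : ℕ) (T : ℝ) :
    linWeight n T = (n + 1) * T / (n + 1 + T ^ 2) := rfl

theorem abs_truncation_factor_le_one (n : ℕ) (T : ℝ) :
    |((n : ℝ) + 1) / (n + 1 + T ^ 2)| ≤ 1 := by
  rw [abs_of_nonneg (by positivity), div_le_one (by positivity)]
  nlinarith [sq_nonneg T]

theorem hasDerivAt_quadWeight (n : ℕ) (T : ℝ) :
    HasDerivAt (quadWeight n) (quadWeightDeriv n T) T := by
  have h0 : (n : ℝ) + 1 + T ^ 2 ≠ 0 := by positivity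
  have h1 := ((hasDerivAt_pow 2 T).const_mul ((n : ℝ) + 1)).div
    ((hasDerivAt_pow 2 T).const_add ((n : ℝ) + 1)) h0
  refine h1.congr_deriv ?_
  change _ = 2 * (((n + 1) * T / (n + 1 + T ^ 2)) * ((n + 1) / (n + 1 + T ^ 2)))
  field_simp
  norm_num
  ring

theorem hasDerivAt_linWeight (n : ℕ) (T : ℝ) :
    HasDerivAt (linWeight n) (linWeightDeriv n T) T := by
  have h0 : (n : ℝ) + 1 + T ^ 2 ≠ 0 := by positivity
  have h1 := ((hasDerivAt_id T).const_mul ((n : ℝ) + 1)).div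
    ((hasDerivAt_pow 2 T).const_add ((n : ℝ) + 1)) h0
  refine h1.congr_deriv ?_
  change _ = (n + 1) * (n + 1 - T ^ 2) / (n + 1 + T ^ 2) ^ 2
  field_simp
  norm_num
  ring

theorem abs_quadWeightDeriv_le (n : ℕ) (T : ℝ) :
    |quadWeightDeriv n T| ≤ 2 * |linWeight n T| := by
  change |2 * (linWeight n T * ((n + 1) / (n + 1 + T ^ 2)))| ≤ _
  rw [abs_mul, abs_mul, abs_two]
  gcongr
  exact mul_le_of_le_one_right (abs_nonneg _) (abs_truncation_factor_le_one n T)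

theorem abs_linWeightDeriv_le (n : ℕ) (T : ℝ) : |linWeightDeriv n T| ≤ 1 :=
  BoundedContinuousFunction.norm_ofNormedAddCommGroup_le _ zero_le_one _ |>.trans' <|
    (linWeightDeriv n).norm_coe_le_norm T

theorem abs_linWeight_sq_le (n : ℕ) (T : ℝ) :
    |(linWeight n * linWeight n) T| ≤ 1 * |quadWeight n T| := by
  have h : (linWeight n * linWeight n) T = quadWeight n T * ((n + 1) / (n + 1 + T ^ 2)) := by
    rw [BoundedContinuousFunction.mul_apply, linWeight_apply, quadWeight_apply]
    ring
  rw [h, abs_mul, one_mul]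
  exact mul_le_of_le_one_right (abs_nonneg _) (abs_truncation_factor_le_one n T)

theorem abs_quadWeight_le (n : ℕ) (T : ℝ) : |quadWeight n T| ≤ |T ^ 2| := by
  have h : quadWeight n T = T ^ 2 * ((n + 1) / (n + 1 + T ^ 2)) := by
    rw [quadWeight_apply]
    ring
  rw [h, abs_mul]
  exact mul_le_of_le_one_right (abs_nonneg _) (abs_truncation_factor_le_one n T)

theorem abs_linWeight_le (n : ℕ) (T : ℝ) : |linWeight n T| ≤ |T| := by
  have h : linWeight n T = T * ((n + 1) / (n + 1 + T ^ 2)) := by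
    rw [linWeight_apply]
    ring
  rw [h, abs_mul]
  exact mul_le_of_le_one_right (abs_nonneg _) (abs_truncation_factor_le_one n T)

theorem tendsto_truncation_factor (T : ℝ) :
    Tendsto (fun n : ℕ => ((n : ℝ) + 1) / (n + 1 + T ^ 2)) atTop (𝓝 1) := by
  have h1 : Tendsto (fun n : ℕ => (n : ℝ) + 1 + T ^ 2) atTop atTop :=
    tendsto_atTop_add_const_right _ _
      (tendsto_atTop_add_const_right _ _ tendsto_natCast_atTop_atTop)
  have h2 : Tendsto (fun n : ℕ => 1 - T ^ 2 / ((n : ℝ) + 1 + T ^ 2)) atTop (𝓝 (1 - 0)) :=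
    tendsto_const_nhds.sub (h1.const_div_atTop _)
  rw [sub_zero] at h2
  refine h2.congr fun n => ?_
  have h0 : (n : ℝ) + 1 + T ^ 2 ≠ 0 := by positivity
  field_simp
  ring

theorem tendsto_quadWeight (T : ℝ) : Tendsto (fun n => quadWeight n T) atTop (𝓝 (T ^ 2)) := by
  have h := (tendsto_truncation_factor T).const_mul (T ^ 2)
  rw [mul_one] at h
  refine h.congr fun n => ?_
  rw [quadWeight_apply]
  ring

theorem tendsto_linWeight (T : ℝ) : Tendsto (fun n => linWeight n T) atTop (𝓝 T) := by
  have h := (tendsto_truncation_factor T).const_mul T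
  rw [mul_one] at h
  refine h.congr fun n => ?_
  rw [linWeight_apply]
  ring

/-! ### Estimates for the weighted norms of a function in `H²(ℝ)` -/

/-- Two integrations by parts control the first derivative with weight `T` by the function with
weight `T²` and the unweighted `H²` norm. -/
theorem norm_linWeight_d1_le (n : ℕ) (u : H2R) {M : ℝ} (hM : ‖u‖ ≤ M) :
    ‖weightMul (linWeight n) u.d1‖ ≤ ‖weightMul (quadWeight n) u.toL2‖ + 3 * M := by
  set b := linWeight n
  set b' := linWeightDeriv n
  have hb := hasDerivAt_linWeight n
  have n0 : ‖u.toL2‖ ≤ M := (PiLp.norm_apply_le u.1 0).trans hM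
  have n2 : ‖u.d2‖ ≤ M := (PiLp.norm_apply_le u.1 2).trans hM
  have hM0 : 0 ≤ M := (norm_nonneg _).trans hM
  have ibp := ((u.2.2.weightMul hb).weightMul hb).inner_eq_neg u.2.1
  have e1 : (inner ℂ (weightMul b u.d1) (weightMul b u.d1) : ℂ) =
      -(inner ℂ u.d2 (weightMul (b * b) u.toL2)
        + 2 * inner ℂ (weightMul b u.d1) (weightMul b' u.toL2)) := by
    change inner ℂ (weightMul b (weightMul b u.d1)) u.d1 = -inner ℂ
      (weightMul b' (weightMul b u.d1) + weightMul b (weightMul b' u.d1 + weightMul b u.d2))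
        u.toL2 at ibp
    rw [map_add, weightMul_comm b b', inner_add_left, inner_add_left, ← weightMul_mul b b u.d2,
      inner_weightMul_left b, inner_weightMul_left b', inner_weightMul_left (b * b)] at ibp
    linear_combination ibp
  have e2 : ‖weightMul b u.d1‖ ^ 2 ≤
      M * ‖weightMul (quadWeight n) u.toL2‖ + 2 * (‖weightMul b u.d1‖ * M) := by
    have h1 : ‖(inner ℂ (weightMul b u.d1) (weightMul b u.d1) : ℂ)‖ = ‖weightMul b u.d1‖ ^ 2 := by
      rw [inner_self_eq_norm_sq_to_K]
      simp
    rw [← h1, e1, norm_neg]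
    refine (norm_add_le _ _).trans (add_le_add ?_ ?_)
    · refine (norm_inner_le_norm _ _).trans ?_
      have := norm_weightMul_le (abs_linWeight_sq_le n) u.toL2
      rw [one_mul] at this
      gcongr
    · rw [norm_mul, RCLike.norm_ofNat]
      gcongr
      refine (norm_inner_le_norm _ _).trans ?_
      gcongr
      exact (norm_weightMul_le_self (abs_linWeightDeriv_le n) u.toL2).trans n0
  -- With `x = ‖b u'‖` and `y = ‖a u‖`, `x² ≤ M y + 2 M x` forces `x ≤ y + 3 M`.
  have := norm_nonneg (weightMul (quadWeight n) u.toL2)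
  have := norm_nonneg (weightMul b u.d1)
  by_contra! h
  nlinarith

/-- The virial estimate. For `w` satisfying the Schrödinger equation pointwise in place of `Q_Z`,
the nonlinear term drops out of `Re ⟪a u, a w⟫` because its potential is real, and integration by
parts moves one derivative of `u''` to the weight. -/
theorem inner_quadWeight_le (n : ℕ) (u : H2R) (w : L2R) (ρ : ℝ)
    (hw : ∀ᵐ T : ℝ, Complex.I * w T + u.d2 T + (ρ : ℂ) * (‖u.toL2 T‖ : ℂ) ^ 2 * u.toL2 T = 0) :
    inner ℝ (weightMul (quadWeight n) u.toL2) (weightMul (quadWeight n) w) ≤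
      ‖weightMul (quadWeight n) u.toL2‖ * (4 * ‖weightMul (linWeight n) u.d1‖) := by
  set a := quadWeight n
  set a' := quadWeightDeriv n
  have ha := hasDerivAt_quadWeight n
  have e0 : inner ℝ (weightMul a u.toL2) (weightMul a w) =
      (Complex.I * inner ℂ (weightMul a (weightMul a u.toL2)) u.d2).re := by
    rw [L2.inner_def, L2.inner_def, ← integral_const_mul]
    have hi := (L2.integrable_inner (𝕜 := ℂ) (weightMul a (weightMul a u.toL2)) u.d2).const_mul
      Complex.I
    refine Eq.trans ?_ (integral_re hi)
    refine integral_congr_ae ?_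
    filter_upwards [hw, coeFn_weightMul a u.toL2, coeFn_weightMul a w,
      coeFn_weightMul a (weightMul a u.toL2)] with T h h1 h2 h3
    have hwT : w T = Complex.I * (u.d2 T + (ρ : ℂ) * (‖u.toL2 T‖ : ℂ) ^ 2 * u.toL2 T) := by
      linear_combination (-Complex.I) * h + w T * Complex.I_sq
    rw [h1, h2, h3, h1, hwT, Complex.inner, RCLike.inner_apply]
    simp only [RCLike.re_to_complex, ← Complex.ofReal_pow, Complex.mul_re, Complex.mul_im,
      Complex.add_re, Complex.add_im, Complex.ofReal_re, Complex.ofReal_im, Complex.I_re,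
      Complex.I_im, Complex.conj_re, Complex.conj_im]
    ring
  have ibp := ((u.2.1.weightMul ha).weightMul ha).inner_eq_neg u.2.2
  have e1 : (inner ℂ (weightMul a (weightMul a u.toL2)) u.d2 : ℂ) =
      -(2 * inner ℂ (weightMul a u.toL2) (weightMul a' u.d1)
        + (‖weightMul a u.d1‖ ^ 2 : ℝ)) := by
    change _ = -inner ℂ (weightMul a' (weightMul a u.toL2)
        + weightMul a (weightMul a' u.toL2 + weightMul a u.d1)) u.d1 at ibp
    refine ibp.trans ?_
    rw [map_add, weightMul_comm a a', inner_add_left, inner_add_left,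
      inner_weightMul_left a', inner_weightMul_left a (weightMul a u.d1),
      inner_self_eq_norm_sq_to_K]
    push_cast
    simp only [Complex.coe_algebraMap]
    ring
  rw [e0, e1]
  have e3 : (Complex.I * -(2 * inner ℂ (weightMul a u.toL2) (weightMul a' u.d1)
        + (‖weightMul a u.d1‖ ^ 2 : ℝ))).re =
      (-(Complex.I * (2 * inner ℂ (weightMul a u.toL2) (weightMul a' u.d1)))).re := by
    simp [-Complex.ofReal_pow]
  rw [e3]
  refine (Complex.re_le_norm _).trans ?_
  rw [norm_neg, norm_mul, norm_mul, Complex.norm_I, RCLike.norm_ofNat, one_mul]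
  have h1 := norm_inner_le_norm (𝕜 := ℂ) (weightMul a u.toL2) (weightMul a' u.d1)
  have h2 := norm_weightMul_le (abs_quadWeightDeriv_le n) u.d1
  have h3 := mul_le_mul_of_nonneg_left h2 (norm_nonneg (weightMul a u.toL2))
  linarith

/-! ### Differential inequalities for norms -/

/-- If `⟪q, q'⟫ ≤ ‖q‖ φ` then `‖q‖` grows at most at rate `φ`. -/
theorem norm_le_norm_add_integral {H : Type*} [NormedAddCommGroup H] [InnerProductSpace ℝ H]
    {q q' : ℝ → H} {φ : ℝ → ℝ} {L : ℝ}
    (hq : ∀ Z ∈ Icc 0 L, HasDerivWithinAt q (q' Z) (Icc 0 L) Z)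
    (hφ : ContinuousOn φ (Icc 0 L)) (hφ0 : ∀ Z ∈ Icc 0 L, 0 ≤ φ Z)
    (h : ∀ Z ∈ Icc 0 L, inner ℝ (q Z) (q' Z) ≤ ‖q Z‖ * φ Z) :
    ∀ Z ∈ Icc 0 L, ‖q Z‖ ≤ ‖q 0‖ + ∫ s in (0 : ℝ)..Z, φ s := by
  intro Z hZ
  have hsub : Icc 0 Z ⊆ Icc 0 L := Icc_subset_Icc_right hZ.2
  -- `‖q‖` need not be differentiable where `q` vanishes, so regularise it with `δ > 0`.
  have key : ∀ δ : ℝ, 0 < δ → ‖q Z‖ ≤ ‖q 0‖ + (∫ s in (0 : ℝ)..Z, φ s) + δ := by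
    intro δ hδ
    have hpos : ∀ s, 0 < ‖q s‖ ^ 2 + δ ^ 2 := fun s => by positivity
    have hd : ∀ s ∈ Icc 0 L, HasDerivWithinAt (fun s => √(‖q s‖ ^ 2 + δ ^ 2))
        (2 * inner ℝ (q s) (q' s) / (2 * √(‖q s‖ ^ 2 + δ ^ 2))) (Icc 0 L) s := fun s hs =>
      (((hq s hs).norm_sq).add_const (δ ^ 2)).sqrt (hpos s).ne'
    have hfin := intervalIntegral.sub_le_integral_of_hasDeriv_right_of_le hZ.1
      (fun s hs => ((hd s (hsub hs)).continuousWithinAt).mono hsub)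
      (fun s hs => by
        refine (hd s (hsub (Ioo_subset_Icc_self hs))).mono_of_mem_nhdsWithin ?_
        exact mem_nhdsWithin_of_mem_nhds (Icc_mem_nhds hs.1 (hs.2.trans_le hZ.2)))
      ((hφ.mono hsub).integrableOn_Icc) (fun s hs => by
        have hs' := hsub (Ioo_subset_Icc_self hs)
        have hle : ‖q s‖ ≤ √(‖q s‖ ^ 2 + δ ^ 2) := Real.le_sqrt_of_sq_le (by nlinarith)
        rw [mul_div_mul_left _ _ two_ne_zero, div_le_iff₀ (Real.sqrt_pos.2 (hpos s))]
        calc _ ≤ ‖q s‖ * φ s := h s hs'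
          _ ≤ _ := by
            rw [mul_comm]
            exact mul_le_mul_of_nonneg_left hle (hφ0 s hs'))
    have h1 : ‖q Z‖ ≤ √(‖q Z‖ ^ 2 + δ ^ 2) := Real.le_sqrt_of_sq_le (by nlinarith)
    have h2 : √(‖q 0‖ ^ 2 + δ ^ 2) ≤ ‖q 0‖ + δ := by
      rw [Real.sqrt_le_left (by positivity)]
      nlinarith [norm_nonneg (q 0)]
    linarith
  exact le_of_forall_pos_le_add key

/-- Grönwall's inequality for `‖q‖²` when `⟪q, q'⟫ ≤ 4 ‖q‖ (‖q‖ + 3M)`. -/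
theorem norm_sq_le_gronwallBound {H : Type*} [NormedAddCommGroup H] [InnerProductSpace ℝ H]
    {q q' : ℝ → H} {L M B : ℝ} (hB : ‖q 0‖ ^ 2 ≤ B)
    (hq : ∀ Z ∈ Icc 0 L, HasDerivWithinAt q (q' Z) (Icc 0 L) Z)
    (h : ∀ Z ∈ Icc 0 L, inner ℝ (q Z) (q' Z) ≤ ‖q Z‖ * (4 * (‖q Z‖ + 3 * M))) :
    ∀ Z ∈ Icc 0 L, ‖q Z‖ ^ 2 ≤ gronwallBound B 20 (12 * M ^ 2) L := by
  intro Z hZ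
  have hd : ∀ s ∈ Icc 0 L, HasDerivWithinAt (fun s => ‖q s‖ ^ 2) (2 * inner ℝ (q s) (q' s))
      (Icc 0 L) s := fun s hs => (hq s hs).norm_sq
  have := le_gronwallBound_of_liminf_deriv_right_le (f := fun s => ‖q s‖ ^ 2)
    (f' := fun s => 2 * inner ℝ (q s) (q' s)) (K := 20) (ε := 12 * M ^ 2)
    (fun s hs => (hd s hs).continuousWithinAt)
    (fun s hs r hr => by
      have h1 := (hd s (Ico_subset_Icc_self hs)).mono_of_mem_nhdsWithin
        (mem_of_superset (Icc_mem_nhdsGE hs.2) (Icc_subset_Icc_left hs.1))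
      simpa [slope_def_field, div_eq_inv_mul] using h1.liminf_right_slope_le hr)
    hB
    (fun s hs => by
      have := h s (Ico_subset_Icc_self hs)
      -- `24 M ‖q‖ ≤ 12 ‖q‖² + 12 M²`, in addition to the term `8 ‖q‖²`.
      nlinarith [sq_nonneg (‖q s‖ - M)]) Z hZ
  refine this.trans (gronwallBound_mono ((sq_nonneg _).trans hB) (by positivity) (by norm_num) ?_)
  linarith [hZ.2]

/-! ### Removing the truncation -/

/-- The product `w f` as an element of `L²(ℝ)`, with the junk value `0` if it is not square
integrable. -/
def unboundedMul (w : ℝ → ℝ) (f : L2R) : L2R :=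
  open Classical in
  if h : MemLp (fun T => (w T : ℂ) * f T) 2 (volume : Measure ℝ) then h.toLp _ else 0

theorem coeFn_unboundedMul {w : ℝ → ℝ} {f : L2R}
    (h : MemLp (fun T => (w T : ℂ) * f T) 2 (volume : Measure ℝ)) :
    unboundedMul w f =ᵐ[volume] fun T => (w T : ℂ) * f T := by
  rw [unboundedMul, dif_pos h]
  exact h.coeFn_toLp

theorem tendsto_ofReal_mul {m : ℕ → ℝ →ᵇ ℝ} {w : ℝ → ℝ}
    (hm : ∀ T, Tendsto (fun n => m n T) atTop (𝓝 (w T))) (f : L2R) (T : ℝ) :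
    Tendsto (fun n => (m n T : ℂ) * f T) atTop (𝓝 ((w T : ℂ) * f T)) :=
  ((Complex.continuous_ofReal.tendsto _).comp (hm T)).mul_const _

/-- Fatou's lemma: a uniform bound on the truncations gives square integrability of the limit. -/
theorem memLp_of_norm_weightMul_le {m : ℕ → ℝ →ᵇ ℝ} {w : ℝ → ℝ}
    (hm : ∀ T, Tendsto (fun n => m n T) atTop (𝓝 (w T))) {f : L2R} {C : ℝ}
    (hC : ∀ n, ‖weightMul (m n) f‖ ≤ C) :
    MemLp (fun T => (w T : ℂ) * f T) 2 (volume : Measure ℝ) := by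
  have hmeas : ∀ n, AEStronglyMeasurable (fun T => (m n T : ℂ) * f T) (volume : Measure ℝ) :=
    fun n => (memLp_weight_mul (m n) f).aestronglyMeasurable
  have hlim := ae_of_all (volume : Measure ℝ) (tendsto_ofReal_mul hm f)
  refine ⟨aestronglyMeasurable_of_tendsto_ae atTop hmeas hlim, ?_⟩
  refine (Lp.eLpNorm_lim_le_liminf_eLpNorm hmeas _ hlim).trans_lt ?_
  have hb : ∀ n, eLpNorm (fun T => (m n T : ℂ) * f T) 2 volume ≤ ENNReal.ofReal C := by
    intro n
    rw [← eLpNorm_congr_ae (coeFn_weightMul (m n) f), ← Lp.enorm_def, ← ofReal_norm]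
    exact ENNReal.ofReal_le_ofReal (hC n)
  refine lt_of_le_of_lt ?_ (ENNReal.ofReal_lt_top (r := C))
  exact (liminf_le_liminf (Eventually.of_forall hb)).trans (by simp)

theorem norm_weightMul_le_unboundedMul {m : ℝ →ᵇ ℝ} {w : ℝ → ℝ} (hle : ∀ T, |m T| ≤ |w T|)
    {f : L2R} (h : MemLp (fun T => (w T : ℂ) * f T) 2 (volume : Measure ℝ)) :
    ‖weightMul m f‖ ≤ ‖unboundedMul w f‖ := by
  refine Lp.norm_le_norm_of_ae_le ?_
  filter_upwards [coeFn_weightMul m f, coeFn_unboundedMul h] with T h1 h2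
  rw [h1, h2, norm_mul, norm_mul, Complex.norm_real, Complex.norm_real]
  exact mul_le_mul_of_nonneg_right (hle T) (norm_nonneg _)

/-- Dominated convergence in `L²(ℝ)` for the truncated products. -/
theorem tendsto_weightMul {m : ℕ → ℝ →ᵇ ℝ} {w : ℝ → ℝ}
    (hm : ∀ T, Tendsto (fun n => m n T) atTop (𝓝 (w T))) (hle : ∀ n T, |m n T| ≤ |w T|)
    {f : L2R} (h : MemLp (fun T => (w T : ℂ) * f T) 2 (volume : Measure ℝ)) :
    Tendsto (fun n => weightMul (m n) f) atTop (𝓝 (unboundedMul w f)) := by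
  rw [unboundedMul, dif_pos h]
  change Tendsto (fun n => (memLp_weight_mul (m n) f).toLp _) atTop _
  rw [Lp.tendsto_Lp_iff_tendsto_eLpNorm'' _ (fun n => memLp_weight_mul (m n) f) _ h]
  have hsq : Tendsto (fun n => ∫⁻ T, ‖(m n T : ℂ) * f T - (w T : ℂ) * f T‖ₑ ^ (2 : ℝ))
      atTop (𝓝 (∫⁻ _ : ℝ, 0)) := by
    refine tendsto_lintegral_of_dominated_convergence'
      (fun T => (2 * ‖(w T : ℂ) * f T‖ₑ) ^ (2 : ℝ)) (fun n => ?_) (fun n => ae_of_all _ fun T => ?_)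
      ?_ (ae_of_all _ fun T => ?_)
    · exact ((memLp_weight_mul (m n) f).aestronglyMeasurable.sub
        h.aestronglyMeasurable).enorm.pow_const _
    · refine ENNReal.rpow_le_rpow ?_ (by norm_num)
      refine (enorm_sub_le).trans ?_
      rw [two_mul]
      refine add_le_add_left ?_ _
      rw [enorm_mul, enorm_mul]
      refine mul_le_mul_left ?_ _
      rw [← ofReal_norm, ← ofReal_norm, Complex.norm_real, Complex.norm_real]
      exact ENNReal.ofReal_le_ofReal (hle n T)
    · have hfin := lintegral_rpow_enorm_lt_top_of_eLpNorm_lt_top two_ne_zero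
        ENNReal.ofNat_ne_top h.eLpNorm_lt_top
      simp_rw [ENNReal.mul_rpow_of_nonneg _ _ (zero_le_two (α := ℝ))]
      rw [lintegral_const_mul' _ _ (by simp)]
      exact (ENNReal.mul_lt_top (by simp) (by simpa using hfin)).ne
    · have h1 := (tendsto_ofReal_mul hm f T).sub_const ((w T : ℂ) * f T)
      rw [sub_self] at h1
      have h2 := ((ENNReal.continuous_rpow_const (y := (2 : ℝ))).tendsto _).comp h1.enorm
      simpa [Function.comp_def] using h2
  rw [lintegral_zero] at hsq
  have h3 := ((ENNReal.continuous_rpow_const (y := (1 / 2 : ℝ))).tendsto _).comp hsq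
  simp only [eLpNorm_eq_lintegral_rpow_enorm_toReal two_ne_zero ENNReal.ofNat_ne_top,
    ENNReal.toReal_ofNat]
  simpa [Function.comp_def] using h3

/-- A family that is a pointwise limit of truncations and bounded in norm lies in `L^∞(I, L²)`. -/
theorem memLp_top_unboundedMul {m : ℕ → ℝ →ᵇ ℝ} {w : ℝ → ℝ}
    (hm : ∀ T, Tendsto (fun n => m n T) atTop (𝓝 (w T))) (hle : ∀ n T, |m n T| ≤ |w T|)
    {f : ℝ → L2R} {L C : ℝ} (hf : ContinuousOn f (Icc 0 L))
    (hmem : ∀ Z ∈ Icc 0 L, MemLp (fun T => (w T : ℂ) * f Z T) 2 (volume : Measure ℝ))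
    (hC : ∀ Z ∈ Icc 0 L, ‖unboundedMul w (f Z)‖ ≤ C) :
    MemLp (fun Z => unboundedMul w (f Z)) ∞ (volume.restrict (Icc 0 L)) := by
  refine memLp_top_of_bound (C := C) ?_ ((ae_restrict_iff' measurableSet_Icc).2 (ae_of_all _ hC))
  refine aestronglyMeasurable_of_tendsto_ae atTop (f := fun n Z => weightMul (m n) (f Z))
    (fun n => ?_) ((ae_restrict_iff' measurableSet_Icc).2 (ae_of_all _ fun Z hZ =>
      tendsto_weightMul hm hle (hmem Z hZ)))
  exact ((weightMul (m n)).continuous.comp_continuousOn hf).aestronglyMeasurable measurableSet_Icc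

/-! ### Propagation of the weighted norms -/

theorem theorem3p4p1 (ρ L : ℝ) (hL : 0 < L) (Q₀ : H2R) (Q : ℝ → H2R)
    (hQ : IsH2Solution ρ L Q₀ Q)
    (h0 : MemLp (fun T : ℝ => (T : ℂ) ^ 2 * Q₀.toL2 T) 2 volume)
    (h1 : MemLp (fun T : ℝ => ((|T| : ℝ) : ℂ) * Q₀.d1 T) 2 volume) :
    ∃ F G : ℝ → L2R,
      (∀ Z ∈ Icc 0 L, ∀ᵐ T : ℝ, F Z T = (T : ℂ) ^ 2 * (Q Z).toL2 T) ∧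
      (∀ Z ∈ Icc 0 L, ∀ᵐ T : ℝ, G Z T = (T : ℂ) * (Q Z).d1 T) ∧
      MemLp F ∞ (volume.restrict (Icc 0 L)) ∧
      MemLp G ∞ (volume.restrict (Icc 0 L)) ∧
      (∃ C : ℝ, ∀ Z ∈ Icc 0 L, ‖F Z‖ ≤ C) ∧
      ∀ Z ∈ Icc 0 L, ‖F Z‖ ≤ ‖F 0‖ + 4 * ∫ s in (0 : ℝ)..Z, ‖G s‖ := by
  obtain ⟨QZ, -, hder, heq⟩ := hQ.exists_deriv
  have hcomp : ∀ i : Fin 3, ContinuousOn (fun Z => (Q Z).1 i) (Icc 0 L) := fun i =>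
    ((PiLp.continuous_apply 2 (fun _ : Fin 3 => L2R) i).comp
      continuous_subtype_val).comp_continuousOn hQ.continuousOn
  have hc0 : ContinuousOn (fun Z => (Q Z).toL2) (Icc 0 L) := hcomp 0
  have hc1 : ContinuousOn (fun Z => (Q Z).d1) (Icc 0 L) := hcomp 1
  obtain ⟨M, hM⟩ := isCompact_Icc.exists_bound_of_continuousOn hQ.continuousOn
  have hmem0 : MemLp (fun T : ℝ => ((T ^ 2 : ℝ) : ℂ) * (Q 0).toL2 T) 2 volume := by
    simpa [hQ.initial] using h0
  have hqder : ∀ n, ∀ Z ∈ Icc 0 L, HasDerivWithinAt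
      (fun Z => weightMul (quadWeight n) (Q Z).toL2) (weightMul (quadWeight n) (QZ Z))
      (Icc 0 L) Z := fun n Z hZ =>
    ((weightMul (quadWeight n)).restrictScalars ℝ).hasFDerivAt.comp_hasDerivWithinAt Z (hder Z hZ)
  have hvir : ∀ n, ∀ Z ∈ Icc 0 L, inner ℝ (weightMul (quadWeight n) (Q Z).toL2)
      (weightMul (quadWeight n) (QZ Z)) ≤ ‖weightMul (quadWeight n) (Q Z).toL2‖ *
        (4 * ‖weightMul (linWeight n) (Q Z).d1‖) := fun n Z hZ =>
    inner_quadWeight_le n (Q Z) (QZ Z) ρ (heq Z hZ)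
  have hd1 : ∀ n, ∀ Z ∈ Icc 0 L, ‖weightMul (linWeight n) (Q Z).d1‖ ≤
      ‖weightMul (quadWeight n) (Q Z).toL2‖ + 3 * M := fun n Z hZ =>
    norm_linWeight_d1_le n (Q Z) (hM Z hZ)
  have hinit : ∀ n, ‖weightMul (quadWeight n) (Q 0).toL2‖ ≤
      ‖unboundedMul (fun T => T ^ 2) (Q 0).toL2‖ := fun n =>
    norm_weightMul_le_unboundedMul (abs_quadWeight_le n) hmem0
  -- A bound for the truncated norms that does not depend on the truncation.
  obtain ⟨C, hC⟩ : ∃ C, ∀ n, ∀ Z ∈ Icc 0 L, ‖weightMul (quadWeight n) (Q Z).toL2‖ ≤ C := by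
    refine ⟨√(gronwallBound (‖unboundedMul (fun T => T ^ 2) (Q 0).toL2‖ ^ 2) 20 (12 * M ^ 2) L),
      fun n Z hZ => Real.le_sqrt_of_sq_le ?_⟩
    refine norm_sq_le_gronwallBound (pow_le_pow_left₀ (norm_nonneg _) (hinit n) 2) (hqder n)
      (fun Z hZ => (hvir n Z hZ).trans ?_) Z hZ
    gcongr
    exact hd1 n Z hZ
  have hmemF : ∀ Z ∈ Icc 0 L, MemLp (fun T : ℝ => ((T ^ 2 : ℝ) : ℂ) * (Q Z).toL2 T) 2 volume :=
    fun Z hZ => memLp_of_norm_weightMul_le tendsto_quadWeight fun n => hC n Z hZ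
  have hmemG : ∀ Z ∈ Icc 0 L, MemLp (fun T : ℝ => (T : ℂ) * (Q Z).d1 T) 2 volume :=
    fun Z hZ => memLp_of_norm_weightMul_le (w := fun T => T) tendsto_linWeight
      (C := C + 3 * M) fun n => (hd1 n Z hZ).trans (by gcongr; exact hC n Z hZ)
  have hF := fun Z (hZ : Z ∈ Icc 0 L) =>
    tendsto_weightMul tendsto_quadWeight abs_quadWeight_le (hmemF Z hZ)
  have hG := fun Z (hZ : Z ∈ Icc 0 L) =>
    tendsto_weightMul (w := fun T => T) tendsto_linWeight abs_linWeight_le (hmemG Z hZ)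
  have hFC : ∀ Z ∈ Icc 0 L, ‖unboundedMul (fun T => T ^ 2) (Q Z).toL2‖ ≤ C := fun Z hZ =>
    le_of_tendsto' (hF Z hZ).norm fun n => hC n Z hZ
  have hGC : ∀ Z ∈ Icc 0 L, ‖unboundedMul (fun T => T) (Q Z).d1‖ ≤ C + 3 * M := fun Z hZ =>
    le_of_tendsto' (hG Z hZ).norm fun n => (hd1 n Z hZ).trans (by gcongr; exact hC n Z hZ)
  have hGtop := memLp_top_unboundedMul (w := fun T => T) tendsto_linWeight abs_linWeight_le hc1
    hmemG hGC
  refine ⟨fun Z => unboundedMul (fun T => T ^ 2) (Q Z).toL2,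
    fun Z => unboundedMul (fun T => T) (Q Z).d1, fun Z hZ => ?_, fun Z hZ => ?_,
    memLp_top_unboundedMul tendsto_quadWeight abs_quadWeight_le hc0 hmemF hFC, hGtop,
    ⟨C, hFC⟩, fun Z hZ => ?_⟩
  · filter_upwards [coeFn_unboundedMul (hmemF Z hZ)] with T hT
    rw [hT, Complex.ofReal_pow]
  · exact coeFn_unboundedMul (hmemG Z hZ)
  · refine le_of_tendsto' (hF Z hZ).norm fun n => ?_
    have hsub : Icc 0 Z ⊆ Icc 0 L := Icc_subset_Icc_right hZ.2
    have hcn : ContinuousOn (fun Z => 4 * ‖weightMul (linWeight n) (Q Z).d1‖) (Icc 0 L) :=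
      continuousOn_const.mul ((weightMul (linWeight n)).continuous.comp_continuousOn hc1).norm
    refine (norm_le_norm_add_integral (hqder n) hcn (fun _ _ => by positivity) (hvir n) Z
      hZ).trans ?_
    refine add_le_add (hinit n) ?_
    rw [← intervalIntegral.integral_const_mul]
    refine intervalIntegral.integral_mono_on hZ.1
      ((hcn.mono hsub).intervalIntegrable_of_Icc hZ.1) ?_ fun s hs => ?_
    · rw [intervalIntegrable_iff_integrableOn_Icc_of_le hZ.1]
      have hi : IntegrableOn (fun s => unboundedMul (fun T => T) (Q s).d1) (Icc 0 L) :=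
        hGtop.integrable le_top
      exact (hi.mono_set hsub).norm.const_mul 4
    · gcongr
      exact norm_weightMul_le_unboundedMul (w := fun T => T) (abs_linWeight_le n)
        (hmemG s (hsub hs))

end
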